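/- Let $a,b,c,A,B,C\in\mathbb{C}$ with $abc\neq 0$ and $ABC\neq 0$. If the equation $$(1+aA^m)(1+bB^m)+cC^m=0$$ holds for infinitely many $m\in\mathbb{N}$, then $A$, $B$ and $C$ are all roots of unity. -/

import Mathlib

/-! This is the Skolem–Mahler–Lech method. Embed the finitely generated `ℚ`-algebra generated by all
the data and by `A⁻¹`, `B⁻¹`, `C⁻¹` into `PadicAlgCl p` so that `A`, `B`, `C` become units
(`exists_injective_padicAlgCl_norm_le_one`). For some `d > 0` their `d`-th powers are close to `1`,
so on a progression `r + d * k` the expression behaves like a function of `k` analytic on a disc of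
radius `2`. Infinitely many zeros force it to vanish for every `k`
(`HasBoundedInterpolation.eq_zero`). An identity between exponentials with bases `1, A, B, A * B, C`
is rigid: `sq_eq_one_of_forall_eq_zero`, applied to the `d`-th powers, makes their squares `1`.
Power series are avoided: uniform Gauss norm bounds on interpolating polynomials replace them. -/

open Polynomial in
/-- The Gauss norm with radius `c` of a polynomial over a normed field. -/
noncomputable abbrev normGauss {K : Type*} [NormedField K] (c : ℝ) (P : K[X]) : ℝ :=
  P.gaussNorm (NormedField.toAbsoluteValue K) c

/-! ### Gauss norms and zeros of interpolated sequences -/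

section Ultrametric

open Polynomial

theorem normGauss_C {K : Type*} [NormedField K] {c : ℝ} (a : K) : normGauss c (C a) = ‖a‖ :=
  gaussNorm_C _ _ _

variable {K : Type*} [NormedField K] [IsUltrametricDist K] {c : ℝ}

theorem isNonarchimedean_toAbsoluteValue : IsNonarchimedean (NormedField.toAbsoluteValue K) :=
  fun x y => IsUltrametricDist.norm_add_le_max x y

theorem normGauss_add_le (hc : 0 ≤ c) (P Q : K[X]) :
    normGauss c (P + Q) ≤ max (normGauss c P) (normGauss c Q) :=
  isNonarchimedean_gaussNorm _ isNonarchimedean_toAbsoluteValue hc P Q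

theorem normGauss_mul (hc : 0 < c) (P Q : K[X]) :
    normGauss c (P * Q) = normGauss c P * normGauss c Q :=
  gaussNorm_mul isNonarchimedean_toAbsoluteValue hc P Q

theorem normGauss_X_sub_natCast (hc : 1 ≤ c) (k : ℕ) :
    normGauss c (X - (k : K[X])) = c := by
  apply le_antisymm
  · have h1 : (X - (k : K[X])) = monomial 1 1 + C (-(k : K)) := by
      simp [monomial_one_one_eq_X, sub_eq_add_neg]
    rw [h1]
    refine (normGauss_add_le (by linarith) _ _).trans (max_le ?_ ?_)
    · refine (gaussNorm_monomial _ _ _ _).le.trans ?_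
      simp
    · rw [normGauss_C, norm_neg]
      exact (IsUltrametricDist.norm_natCast_le_one K k).trans hc
  · have := le_gaussNorm (NormedField.toAbsoluteValue K) (X - (k : K[X]))
      (show 0 ≤ c by linarith) 1
    have h1 : (X - (k : K[X])).coeff 1 = 1 := by
      rw [coeff_sub, coeff_X_one, ← C_eq_natCast, coeff_C_succ, sub_zero]
    rwa [h1, pow_one, map_one, one_mul] at this

theorem norm_eval_le_normGauss (hc : 1 ≤ c) (P : K[X]) {x : K} (hx : ‖x‖ ≤ 1) :
    ‖P.eval x‖ ≤ normGauss c P := by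
  rw [eval_eq_sum_range]
  refine IsUltrametricDist.norm_sum_le_of_forall_le_of_nonneg
    (gaussNorm_nonneg _ _ (by linarith)) fun i _ => ?_
  refine le_trans ?_ (le_gaussNorm (NormedField.toAbsoluteValue K) P (show 0 ≤ c by linarith) i)
  rw [norm_mul, norm_pow]
  change _ ≤ ‖P.coeff i‖ * c ^ i
  gcongr
  exact hx.trans hc

theorem normGauss_prod_X_sub_natCast (hc : 1 ≤ c) (T : Finset ℕ) :
    normGauss c (∏ k ∈ T, (X - (k : K[X]))) = c ^ T.card := by
  induction T using Finset.induction_on with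
  | empty => simpa using normGauss_C (c := c) (1 : K)
  | insert k T hk ih =>
    rw [Finset.prod_insert hk, normGauss_mul (by linarith), ih, Finset.card_insert_of_notMem hk,
      normGauss_X_sub_natCast hc, pow_succ']

/-- A polynomial with many natural numbers among its roots is small at every natural number. -/
theorem norm_eval_mul_pow_card_le [CharZero K] (hc : 1 ≤ c) (P : K[X]) (T : Finset ℕ)
    (hT : ∀ k ∈ T, P.eval (k : K) = 0) (n : ℕ) :
    ‖P.eval (n : K)‖ * c ^ T.card ≤ normGauss c P := by
  have hdvd : (∏ k ∈ T, (X - (k : K[X]))) ∣ P := by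
    refine Finset.prod_dvd_of_coprime ?_ fun k hk => ?_
    · intro i _ j _ hij
      have := pairwise_coprime_X_sub_C (K := K) (s := fun k : ℕ => (k : K)) Nat.cast_injective hij
      simpa [Function.onFun] using this
    · simpa using dvd_iff_isRoot.mpr (hT k hk)
  obtain ⟨Q, hQ⟩ := hdvd
  have hn : ‖(n : K)‖ ≤ 1 := IsUltrametricDist.norm_natCast_le_one K n
  -- The linear factors take integer values at `n`, of norm at most one, so the quotient alone
  -- bounds the value.
  have h1 : ‖P.eval (n : K)‖ ≤ normGauss c Q := by
    rw [hQ, eval_mul, norm_mul]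
    have h2 : ‖(∏ k ∈ T, (X - (k : K[X]))).eval (n : K)‖ ≤ 1 := by
      rw [eval_prod, norm_prod]
      refine Finset.prod_le_one (fun _ _ => norm_nonneg _) fun k _ => ?_
      have := IsUltrametricDist.norm_intCast_le_one K ((n : ℤ) - k)
      simpa using this
    calc _ ≤ 1 * normGauss c Q :=
          mul_le_mul h2 (norm_eval_le_normGauss hc Q hn) (norm_nonneg _) zero_le_one
      _ = _ := one_mul _
  conv_rhs => rw [hQ]
  rw [normGauss_mul (by linarith), normGauss_prod_X_sub_natCast hc, mul_comm]
  gcongr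

/-- A sequence is polynomially interpolated at radius `c` if its initial segments are interpolated
by polynomials of uniformly bounded Gauss norm. -/
def HasBoundedInterpolation (c : ℝ) (f : ℕ → K) : Prop :=
  ∃ D : ℝ, ∀ M : ℕ, ∃ P : K[X], normGauss c P ≤ D ∧ ∀ k ≤ M, P.eval (k : K) = f k

theorem HasBoundedInterpolation.add (hc : 0 ≤ c) {f g : ℕ → K} (hf : HasBoundedInterpolation c f)
    (hg : HasBoundedInterpolation c g) : HasBoundedInterpolation c (fun k => f k + g k) := by
  obtain ⟨D, hD⟩ := hf
  obtain ⟨E, hE⟩ := hg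
  refine ⟨max D E, fun M => ?_⟩
  obtain ⟨P, hP, hP'⟩ := hD M
  obtain ⟨Q, hQ, hQ'⟩ := hE M
  exact ⟨P + Q, (normGauss_add_le hc P Q).trans (max_le_max hP hQ),
    fun k hk => by rw [eval_add, hP' k hk, hQ' k hk]⟩

theorem HasBoundedInterpolation.const_mul (hc : 0 < c) {f : ℕ → K}
    (hf : HasBoundedInterpolation c f) (a : K) :
    HasBoundedInterpolation c (fun k => a * f k) := by
  obtain ⟨D, hD⟩ := hf
  refine ⟨‖a‖ * D, fun M => ?_⟩
  obtain ⟨P, hP, hP'⟩ := hD M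
  refine ⟨C a * P, ?_, fun k hk => by rw [eval_mul, eval_C, hP' k hk]⟩
  rw [normGauss_mul hc, normGauss_C]
  gcongr

/-- With `s` zeros, `‖f n‖ * c ^ s ≤ D` where `D` does not depend on `s`; let `s` grow. -/
theorem HasBoundedInterpolation.eq_zero [CharZero K] (hc : 1 < c) {f : ℕ → K}
    (hf : HasBoundedInterpolation c f) (hinf : {k | f k = 0}.Infinite) (n : ℕ) : f n = 0 := by
  obtain ⟨D, hD⟩ := hf
  by_contra hn
  obtain ⟨s, hs⟩ := pow_unbounded_of_one_lt (D / ‖f n‖) hc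
  obtain ⟨T, hT, hcard⟩ := hinf.exists_subset_card_eq s
  obtain ⟨P, hP, hP'⟩ := hD (max n (T.sup id))
  have := norm_eval_mul_pow_card_le hc.le P T (fun k hk => by
    rw [hP' k ((Finset.le_sup (f := id) hk).trans (le_max_right _ _))]
    exact hT hk) n
  rw [hP' n (le_max_left _ _), hcard] at this
  have hpos : 0 < ‖f n‖ := norm_pos_iff.mpr hn
  rw [div_lt_iff₀ hpos] at hs
  linarith

theorem normGauss_descPochhammer_le (hc : 1 ≤ c) (j : ℕ) :
    normGauss c (descPochhammer K j) ≤ c ^ j := by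
  induction j with
  | zero => simpa using (normGauss_C (c := c) (1 : K)).le
  | succ j ih =>
    rw [descPochhammer_succ_right, normGauss_mul (by linarith), normGauss_X_sub_natCast hc,
      pow_succ]
    gcongr

/-- The interpolants are truncations of Newton's series `∑ x ^ j * (k choose j)`, exact for `k ≤ M`
because the later binomials vanish. -/
theorem hasBoundedInterpolation_one_add_pow [CharZero K] (hc : 1 ≤ c) (x : K)
    (hx : ∀ j : ℕ, ‖x‖ ^ j * c ^ j ≤ ‖(j.factorial : K)‖) :
    HasBoundedInterpolation c (fun k => (1 + x) ^ k) := by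
  refine ⟨1, fun M => ⟨∑ j ∈ Finset.range (M + 1),
    C (x ^ j / (j.factorial : K)) * descPochhammer K j, ?_, fun k hk => ?_⟩⟩
  · induction M + 1 with
    | zero => simp
    | succ m ih =>
      rw [Finset.sum_range_succ]
      refine (normGauss_add_le (by linarith) _ _).trans (max_le ih ?_)
      have h0 : 0 < ‖(m.factorial : K)‖ := norm_pos_iff.mpr (by exact_mod_cast m.factorial_ne_zero)
      rw [normGauss_mul (by linarith), normGauss_C, norm_div, norm_pow, div_mul_eq_mul_div,
        div_le_one h0]
      refine le_trans ?_ (hx m)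
      gcongr
      exact normGauss_descPochhammer_le hc m
  · have hsub : Finset.range (k + 1) ⊆ Finset.range (M + 1) :=
      Finset.range_subset_range.mpr (by omega)
    change _ = (1 + x) ^ k
    rw [add_comm 1 x, add_pow, eval_finsetSum, ← Finset.sum_subset hsub]
    · refine Finset.sum_congr rfl fun j _ => ?_
      rw [eval_mul, eval_C, descPochhammer_eval_eq_descFactorial, Nat.descFactorial_eq_factorial_mul_choose]
      have h0 : (j.factorial : K) ≠ 0 := by exact_mod_cast j.factorial_ne_zero
      push_cast
      field_simp
      simp
    · intro j _ hj
      rw [eval_mul, descPochhammer_eval_eq_descFactorial, Nat.descFactorial_of_lt (by simpa using hj)]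
      simp

end Ultrametric

/-! ### Embedding finitely generated domains into p-adic integers -/

section Embedding

open Cardinal

/-- There are arbitrarily large finite families of `p`-adic integers that are algebraically
independent over `ℚ`. -/
theorem exists_algebraicIndependent_norm_le_one (p : ℕ) [Fact p.Prime] (s : ℕ) :
    ∃ τ : Fin s → ℚ_[p], AlgebraicIndependent ℚ τ ∧ ∀ i, ‖τ i‖ ≤ 1 := by
  -- Scaling by powers of `p` shows that the unit ball generates `ℚ_[p]`, so it contains a
  -- transcendence basis; a finite one would make `ℚ_[p]` countable.
  have hadj : Algebra.adjoin ℚ (Metric.closedBall (0 : ℚ_[p]) 1) = ⊤ := by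
    refine top_le_iff.mp fun x _ => ?_
    obtain ⟨n, hn⟩ := pow_unbounded_of_one_lt ‖x‖
      (show (1 : ℝ) < p by exact_mod_cast (Fact.out : p.Prime).one_lt)
    have hp0 : (p : ℚ_[p]) ≠ 0 := by exact_mod_cast (Fact.out : p.Prime).ne_zero
    have hx : x = ((p : ℚ) ^ n)⁻¹ • ((p : ℚ_[p]) ^ n * x) := by
      rw [Algebra.smul_def]
      simp [hp0]
    rw [hx]
    refine Subalgebra.smul_mem _ (Algebra.subset_adjoin ?_) _
    rw [mem_closedBall_zero_iff, norm_mul, norm_pow, Padic.norm_p, inv_pow,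
      inv_mul_le_one₀ (by have := (Fact.out : p.Prime).pos; positivity)]
    exact hn.le
  have halg : Algebra.IsAlgebraic (Algebra.adjoin ℚ (Metric.closedBall (0 : ℚ_[p]) 1)) ℚ_[p] :=
    ⟨fun x => isAlgebraic_algebraMap (⟨x, hadj ▸ Algebra.mem_top⟩ :
      Algebra.adjoin ℚ (Metric.closedBall (0 : ℚ_[p]) 1))⟩
  obtain ⟨t, ht, htb⟩ := exists_isTranscendenceBasis_subset (R := ℚ)
    (Metric.closedBall (0 : ℚ_[p]) 1)
  have hinf : Infinite t := by
    by_contra hfin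
    rw [not_infinite_iff_finite] at hfin
    have := htb.isAlgebraic
    have h1 := Algebra.IsAlgebraic.cardinalMk_le_max
      (Algebra.adjoin ℚ (Set.range ((↑) : t → ℚ_[p]))) ℚ_[p]
    have h2 : #(Algebra.adjoin ℚ (Set.range ((↑) : t → ℚ_[p]))) ≤ ℵ₀ := by
      rw [← Cardinal.mk_congr htb.1.aevalEquiv.toEquiv]
      exact MvPolynomial.cardinalMk_le_max.trans (by simp)
    have h3 := (continuum_le_cardinal_of_nontriviallyNormedField ℚ_[p]).trans
      (h1.trans (max_le h2 le_rfl))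
    exact absurd h3 (not_le.mpr aleph0_lt_continuum)
  refine ⟨fun i => (Infinite.natEmbedding t i : t), htb.1.comp _ ?_, fun i => ?_⟩
  · exact (Infinite.natEmbedding t).injective.comp Fin.val_injective
  · simpa using ht (Infinite.natEmbedding t i : t).2

/-- A root of a monic polynomial with coefficients of norm at most one has norm at most one. -/
theorem norm_le_one_of_monic_eval_eq_zero {K : Type*} [NormedField K] [IsUltrametricDist K]
    {f : Polynomial K} (hf : f.Monic) (hcoeff : ∀ n, ‖f.coeff n‖ ≤ 1) {x : K}
    (hx : f.eval x = 0) : ‖x‖ ≤ 1 := by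
  by_contra! h
  have hsum : x ^ f.natDegree = - ∑ i ∈ Finset.range f.natDegree, f.coeff i * x ^ i := by
    rw [Polynomial.eval_eq_sum_range, Finset.sum_range_succ, hf.coeff_natDegree, one_mul] at hx
    linear_combination hx
  have hpos : 0 < f.natDegree := by
    rcases Nat.eq_zero_or_pos f.natDegree with h0 | h0
    · rw [h0] at hsum
      simp at hsum
    · exact h0
  have : ‖x ^ f.natDegree‖ ≤ ‖x‖ ^ (f.natDegree - 1) := by
    rw [hsum, norm_neg]
    refine IsUltrametricDist.norm_sum_le_of_forall_le_of_nonneg (by positivity) fun i hi => ?_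
    rw [norm_mul, norm_pow]
    calc _ ≤ 1 * ‖x‖ ^ (f.natDegree - 1) := by
          gcongr
          · exact hcoeff i
          · exact h.le
          · have := Finset.mem_range.mp hi; omega
      _ = _ := one_mul _
  rw [norm_pow] at this
  exact absurd this (not_le.mpr (pow_lt_pow_right₀ h (by omega)))

/-- For finitely many rational numbers there is a prime at which all of them are integral. -/
theorem exists_prime_forall_not_dvd_den (Q : Finset ℚ) :
    ∃ p : ℕ, p.Prime ∧ ∀ q ∈ Q, ¬ p ∣ q.den := by
  obtain ⟨p, hle, hp⟩ := Nat.exists_infinite_primes (Q.sup (fun q => q.den) + 1)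
  refine ⟨p, hp, fun q hq hdvd => ?_⟩
  have h1 := Nat.le_of_dvd q.pos hdvd
  have h2 : q.den ≤ Q.sup (fun q => q.den) := Finset.le_sup (f := fun q : ℚ => q.den) hq
  omega

/-- Finitely many elements of a domain that is finitely generated over `ℚ` can be embedded into
the integers of an algebraic closure of `ℚ_[p]`, for some prime `p`. -/
theorem exists_injective_padicAlgCl_norm_le_one {R : Type*} [CommRing R] [IsDomain R] [Algebra ℚ R]
    [Algebra.FiniteType ℚ R] (S : Finset R) :
    ∃ (p : ℕ) (_ : Fact p.Prime) (φ : R →+* PadicAlgCl p),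
      Function.Injective φ ∧ ∀ x ∈ S, ‖φ x‖ ≤ 1 := by
  -- Noether normalization: `R` is integral over a polynomial ring, whose variables are sent to
  -- independent p-adic integers.
  obtain ⟨s, g, ginj, gint⟩ := exists_integral_inj_algHom_of_fg ℚ R
  have hroot : ∀ x : R, ∃ f : Polynomial (MvPolynomial (Fin s) ℚ), f.Monic ∧
      f.eval₂ (g : MvPolynomial (Fin s) ℚ →+* R) x = 0 := fun x => gint x
  choose f fmonic froot using hroot
  classical
  obtain ⟨p, hp, hden⟩ := exists_prime_forall_not_dvd_den
    (S.biUnion fun x => (f x).support.biUnion fun n =>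
      ((f x).coeff n).support.image fun m => ((f x).coeff n).coeff m)
  have : Fact p.Prime := ⟨hp⟩
  obtain ⟨τ, τind, τle⟩ := exists_algebraicIndependent_norm_le_one p s
  let σ : MvPolynomial (Fin s) ℚ →+* PadicAlgCl p :=
    (algebraMap ℚ_[p] (PadicAlgCl p)).comp (MvPolynomial.aeval τ : _ →ₐ[ℚ] ℚ_[p])
  have σinj : Function.Injective σ :=
    (algebraMap ℚ_[p] (PadicAlgCl p)).injective.comp
      (algebraicIndependent_iff_injective_aeval.mp τind)
  let : Algebra (MvPolynomial (Fin s) ℚ) R := (g : MvPolynomial (Fin s) ℚ →+* R).toAlgebra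
  let : Algebra (MvPolynomial (Fin s) ℚ) (PadicAlgCl p) := σ.toAlgebra
  have : FaithfulSMul (MvPolynomial (Fin s) ℚ) R :=
    (faithfulSMul_iff_algebraMap_injective _ _).mpr ginj
  have : FaithfulSMul (MvPolynomial (Fin s) ℚ) (PadicAlgCl p) :=
    (faithfulSMul_iff_algebraMap_injective _ _).mpr σinj
  have : Algebra.IsIntegral (MvPolynomial (Fin s) ℚ) R := ⟨gint⟩
  have : Module.IsTorsionFree (MvPolynomial (Fin s) ℚ) R := inferInstance
  have : Module.IsTorsionFree (MvPolynomial (Fin s) ℚ) (PadicAlgCl p) := inferInstance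
  let φ : R →ₐ[MvPolynomial (Fin s) ℚ] PadicAlgCl p := IsAlgClosed.lift
  refine ⟨p, ‹_›, φ, ?_, fun x hx => ?_⟩
  · rw [RingHom.injective_iff_ker_eq_bot]
    -- In an integral extension of domains a nonzero ideal meets the base ring nontrivially.
    apply Ideal.eq_bot_of_comap_eq_bot (R := MvPolynomial (Fin s) ℚ)
    rw [eq_bot_iff]
    intro y hy
    have h1 : φ (algebraMap _ R y) = 0 := hy
    rw [φ.commutes] at h1
    exact (map_eq_zero_iff σ σinj).mp h1
  · refine norm_le_one_of_monic_eval_eq_zero ((fmonic x).map σ) (fun n => ?_) ?_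
    · rw [Polynomial.coeff_map]
      by_cases hn : n ∈ (f x).support
      · change ‖algebraMap ℚ_[p] (PadicAlgCl p) (MvPolynomial.aeval τ ((f x).coeff n))‖ ≤ 1
        rw [norm_algebraMap', MvPolynomial.aeval_def, MvPolynomial.eval₂_eq]
        refine IsUltrametricDist.norm_sum_le_of_forall_le_of_nonneg zero_le_one fun m hm => ?_
        rw [norm_mul, norm_prod]
        refine mul_le_one₀ ?_ (Finset.prod_nonneg fun _ _ => norm_nonneg _)
          (Finset.prod_le_one (fun _ _ => norm_nonneg _) fun i _ => ?_)
        · rw [eq_ratCast]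
          refine Padic.norm_rat_le_one (hden _ ?_)
          simp only [Finset.mem_biUnion, Finset.mem_image]
          exact ⟨x, hx, n, hn, m, hm, rfl⟩
        · rw [norm_pow]
          exact pow_le_one₀ (norm_nonneg _) (τle i)
      · rw [Polynomial.notMem_support_iff.mp hn]
        simp
    · have h1 := congrArg φ (froot x)
      rw [map_zero] at h1
      have h2 := Polynomial.hom_eval₂ (f x) (g : MvPolynomial (Fin s) ℚ →+* R) (φ : R →+* PadicAlgCl p) x
      have h3 : (φ : R →+* PadicAlgCl p).comp (g : MvPolynomial (Fin s) ℚ →+* R) = σ :=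
        φ.comp_algebraMap
      rw [h3] at h2
      rw [Polynomial.eval_map, ← h2]
      exact h1

end Embedding

/-! ### Powers of p-adic units and exponential identities -/

/-- An element of norm one in an algebraic closure of `ℚ_[p]` has powers arbitrarily close
to `1`. -/
theorem PadicAlgCl.exists_norm_pow_sub_one_le {p : ℕ} [Fact p.Prime] (x : PadicAlgCl p)
    (hx : ‖x‖ = 1) {δ : ℝ} (hδ : 0 < δ) : ∃ d : ℕ, 0 < d ∧ ‖x ^ d - 1‖ ≤ δ := by
  have hint : IsIntegral ℚ_[p] x := Algebra.IsIntegral.isIntegral x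
  let V : Submodule ℚ_[p] (PadicAlgCl p) := Subalgebra.toSubmodule (Algebra.adjoin ℚ_[p] {x})
  have hfg : FiniteDimensional ℚ_[p] V := by
    have := hint.fg_adjoin_singleton
    exact Module.Finite.iff_fg.mpr this
  -- Compactness of the unit ball is available in the finite-dimensional `ℚ_[p]`-algebra generated
  -- by `x`; it yields two close powers of `x`.
  have : ProperSpace V := FiniteDimensional.proper ℚ_[p] V
  let u : ℕ → V := fun n => ⟨x ^ n, pow_mem (Algebra.self_mem_adjoin_singleton ℚ_[p] x) n⟩
  obtain ⟨y, -, ψ, hψ, hlim⟩ := (isCompact_closedBall (0 : V) 1).tendsto_subseq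
    (x := u) (fun n => by
      rw [mem_closedBall_zero_iff]
      change ‖x ^ n‖ ≤ 1
      simp [hx])
  obtain ⟨N, hN⟩ := Metric.cauchySeq_iff'.mp hlim.cauchySeq δ hδ
  have h1 := hN (N + 1) (Nat.le_succ N)
  have hlt : ψ N < ψ (N + 1) := hψ (Nat.lt_succ_self N)
  refine ⟨ψ (N + 1) - ψ N, Nat.sub_pos_of_lt hlt, ?_⟩
  have h2 : ‖x ^ ψ (N + 1) - x ^ ψ N‖ < δ := by
    rw [dist_eq_norm] at h1
    exact h1
  have h3 : x ^ ψ (N + 1) - x ^ ψ N = x ^ ψ N * (x ^ (ψ (N + 1) - ψ N) - 1) := by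
    rw [mul_sub, ← pow_add, Nat.add_sub_cancel' hlt.le, mul_one]
  rw [h3, norm_mul, norm_pow, hx, one_pow, one_mul] at h2
  exact h2.le

theorem norm_pow_sub_one_le_of_norm_sub_one_le {K : Type*} [NormedField K] [IsUltrametricDist K]
    {x : K} (hx : ‖x‖ ≤ 1) {δ : ℝ} (h : ‖x - 1‖ ≤ δ) (n : ℕ) : ‖x ^ n - 1‖ ≤ δ := by
  induction n with
  | zero => simpa using (norm_nonneg _).trans h
  | succ n ih =>
    have : x ^ (n + 1) - 1 = x * (x ^ n - 1) + (x - 1) := by ring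
    rw [this]
    refine (IsUltrametricDist.norm_add_le_max _ _).trans (max_le ?_ h)
    rw [norm_mul]
    exact (mul_le_of_le_one_left (norm_nonneg _) hx).trans ih

/-- The factorial is not too small `p`-adically. -/
theorem PadicAlgCl.inv_pow_le_norm_factorial {p : ℕ} [Fact p.Prime] (j : ℕ) :
    ((p : ℝ)⁻¹) ^ j ≤ ‖(j.factorial : PadicAlgCl p)‖ := by
  have hp := (Fact.out : p.Prime)
  rw [← map_natCast (algebraMap ℚ_[p] (PadicAlgCl p)), norm_algebraMap',
    Padic.norm_eq_zpow_neg_valuation (by exact_mod_cast j.factorial_ne_zero),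
    Padic.valuation_natCast, zpow_neg, zpow_natCast, inv_pow]
  have h1 : (1 : ℝ) ≤ p := by exact_mod_cast hp.one_lt.le
  exact inv_anti₀ (by positivity) (pow_le_pow_right₀ h1 (padicValNat_factorial_le p j))

/-- If a power sum identity holds for all exponents, then it extends to all polynomials. -/
theorem five_term_eval_eq_zero {K : Type*} [Field K] {a b c A B C : K}
    (h : ∀ k : ℕ, (1 + a * A ^ k) * (1 + b * B ^ k) + c * C ^ k = 0) (P : Polynomial K) :
    P.eval 1 + a * P.eval A + b * P.eval B + a * b * P.eval (A * B) + c * P.eval C = 0 := by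
  induction P using Polynomial.induction_on' with
  | add P Q hP hQ =>
    simp only [Polynomial.eval_add]
    linear_combination hP + hQ
  | monomial n r =>
    simp only [Polynomial.eval_monomial, one_pow, mul_pow]
    linear_combination r * h n

/-! ### Rigidity of the five-term identity -/

section FiveTerms

open Polynomial (X)

/-- If `B ≠ 1`, then `C` equals `1` or `B`; isolating the other base gives `1 + a = 0`, and then `c
= 0`. -/
theorem eq_one_of_forall_eq_zero {K : Type*} [Field K] {a b c B C : K} (hb : b ≠ 0) (hc : c ≠ 0)
    (h : ∀ k : ℕ, (1 + a * 1 ^ k) * (1 + b * B ^ k) + c * C ^ k = 0) : B = 1 ∧ C = 1 := by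
  have hP := five_term_eval_eq_zero h
  have h1 := hP ((X - Polynomial.C 1) * (X - Polynomial.C B))
  have h2 := hP (X - Polynomial.C 1)
  have h3 := hP (X - Polynomial.C B)
  simp only [Polynomial.eval_mul, Polynomial.eval_sub, Polynomial.eval_X,
    Polynomial.eval_C] at h1 h2 h3
  have h4 : c * ((C - 1) * (C - B)) = 0 := by linear_combination h1
  have hB : B = 1 := by
    by_contra hne
    have hne' := sub_ne_zero.mpr hne
    rcases mul_eq_zero.mp ((mul_eq_zero.mp h4).resolve_left hc) with h5 | h5
    · have h6 : (b * (B - 1)) * (1 + a) = 0 := by linear_combination h2 - c * h5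
      have h7 := (mul_eq_zero.mp h6).resolve_left (by simp [hb, hne'])
      have h8 : c * (B - 1) = 0 := by linear_combination -h3 + c * h5 - (B - 1) * h7
      simp_all
    · have h6 : (B - 1) * (1 + a) = 0 := by linear_combination -h3 + c * h5
      have h7 := (mul_eq_zero.mp h6).resolve_left (by simp [hne'])
      have h8 : c * (B - 1) = 0 := by linear_combination h2 - c * h5 - b * (B - 1) * h7
      simp_all
  refine ⟨hB, ?_⟩
  rw [hB] at h4
  simpa [hc, sub_eq_zero] using h4

/-- A polynomial vanishing at all bases but one isolates a single term, whose product of differences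
is then zero. This forces coincidences among the bases. -/
theorem sq_eq_one_of_forall_eq_zero {K : Type*} [Field K] {a b c A B C : K} (ha : a ≠ 0)
    (hb : b ≠ 0) (hc : c ≠ 0) (hA : A ≠ 0) (hB : B ≠ 0)
    (h : ∀ k : ℕ, (1 + a * A ^ k) * (1 + b * B ^ k) + c * C ^ k = 0) :
    A ^ 2 = 1 ∧ B ^ 2 = 1 ∧ C ^ 2 = 1 := by
  by_cases hA1 : A = 1
  · subst hA1
    obtain ⟨rfl, rfl⟩ := eq_one_of_forall_eq_zero hb hc h
    simp
  by_cases hB1 : B = 1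
  · subst hB1
    obtain ⟨rfl, rfl⟩ := eq_one_of_forall_eq_zero (a := b) (b := a) (B := A) (C := C) ha hc fun k => by
      linear_combination h k
    simp
  have hP := five_term_eval_eq_zero h
  have hA1' := sub_ne_zero.mpr hA1
  have hB1' := sub_ne_zero.mpr hB1
  have hAB : A = B := by
    by_contra hne
    have hne' := sub_ne_zero.mpr hne
    have hAC : A = C := by
      have h1 := hP ((X - Polynomial.C 1) * (X - Polynomial.C B) * (X - Polynomial.C (A * B)) *
        (X - Polynomial.C C))
      have h2 : a * ((A - 1) * (A - B) * (A * (B - 1))) * (A - C) = 0 := by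
        simp only [Polynomial.eval_mul, Polynomial.eval_sub, Polynomial.eval_X,
          Polynomial.eval_C] at h1
        linear_combination -h1
      exact sub_eq_zero.mp ((mul_eq_zero.mp h2).resolve_left (by simp [ha, hA, hA1', hB1', hne']))
    have hBC : B = C := by
      have h1 := hP ((X - Polynomial.C 1) * (X - Polynomial.C A) * (X - Polynomial.C (A * B)) *
        (X - Polynomial.C C))
      have h2 : b * ((B - 1) * (A - B) * (B * (A - 1))) * (B - C) = 0 := by
        simp only [Polynomial.eval_mul, Polynomial.eval_sub, Polynomial.eval_X,
          Polynomial.eval_C] at h1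
        linear_combination h1
      exact sub_eq_zero.mp ((mul_eq_zero.mp h2).resolve_left (by simp [hb, hB, hA1', hB1', hne']))
    exact hne (hAC.trans hBC.symm)
  subst hAB
  have hA2 : A ^ 2 = 1 := by
    by_contra hne
    have hne' := sub_ne_zero.mpr hne
    -- The bases are now `1`, `A`, `A ^ 2`, `C`. Isolating `1` gives `C = 1`; isolating `A ^ 2`
    -- gives `A ^ 2 = C`, a contradiction.
    have hC1 : C = 1 := by
      have h1 := hP ((X - Polynomial.C A) * (X - Polynomial.C (A * A)) * (X - Polynomial.C C))
      have h2 : (A - 1) * (A ^ 2 - 1) * (C - 1) = 0 := by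
        simp only [Polynomial.eval_mul, Polynomial.eval_sub, Polynomial.eval_X,
          Polynomial.eval_C] at h1
        linear_combination -h1
      exact sub_eq_zero.mp ((mul_eq_zero.mp h2).resolve_left (by simp [hA1', hne']))
    have h1 := hP ((X - Polynomial.C 1) * (X - Polynomial.C A) * (X - Polynomial.C C))
    have h2 : a * b * ((A ^ 2 - 1) * (A * (A - 1))) * (A ^ 2 - C) = 0 := by
      simp only [Polynomial.eval_mul, Polynomial.eval_sub, Polynomial.eval_X,
        Polynomial.eval_C] at h1
      linear_combination h1
    rw [hC1] at h2
    exact hne' ((mul_eq_zero.mp h2).resolve_left (by simp [ha, hb, hA, hA1', hne']))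
  refine ⟨hA2, hA2, ?_⟩
  have h1 := hP ((X - Polynomial.C 1) * (X - Polynomial.C A))
  have h2 : c * ((C - 1) * (C - A)) = 0 := by
    simp only [Polynomial.eval_mul, Polynomial.eval_sub, Polynomial.eval_X,
      Polynomial.eval_C] at h1
    linear_combination h1 - a * b * A * (A - 1) * hA2
  rcases mul_eq_zero.mp ((mul_eq_zero.mp h2).resolve_left hc) with h3 | h3
  · rw [sub_eq_zero.mp h3, one_pow]
  · rw [sub_eq_zero.mp h3, hA2]

end FiveTerms

/-! ### Passage to a progression and conclusion -/

theorem Set.Infinite.exists_infinite_setOf_add_mul_mem {S : Set ℕ} (hS : S.Infinite) {d : ℕ}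
    (hd : 0 < d) : ∃ r, {k | r + d * k ∈ S}.Infinite := by
  by_contra! h
  refine hS (Set.Finite.subset (Set.Finite.biUnion (Set.finite_lt_nat d)
    fun r _ => (h r).image fun k => r + d * k) fun m hm => ?_)
  simp only [Set.mem_iUnion, Set.mem_image, Set.mem_ofPred_eq]
  exact ⟨m % d, Nat.mod_lt m hd, m / d, by simpa [Nat.mod_add_div] using hm, Nat.mod_add_div m d⟩

theorem PadicAlgCl.hasBoundedInterpolation_pow {p : ℕ} [Fact p.Prime] {y : PadicAlgCl p}
    (hy : ‖y - 1‖ ≤ ((p : ℝ) * 2)⁻¹) : HasBoundedInterpolation 2 (fun k => y ^ k) := by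
  -- The radius `2` uses up the factor `2` in the hypothesis, leaving `p⁻¹ ^ j`, a lower bound for
  -- the norm of `j !`.
  have h := hasBoundedInterpolation_one_add_pow (c := 2) one_le_two (y - 1) fun j => by
    refine le_trans ?_ (PadicAlgCl.inv_pow_le_norm_factorial j)
    rw [← mul_pow]
    have hp : (0 : ℝ) < p := by exact_mod_cast (Fact.out : p.Prime).pos
    gcongr
    calc ‖y - 1‖ * 2 ≤ ((p : ℝ) * 2)⁻¹ * 2 := by gcongr
      _ = (p : ℝ)⁻¹ := by field_simp
  simpa using h

theorem PadicAlgCl.exists_pow_eq_one_of_infinite {p : ℕ} [Fact p.Prime]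
    {a b c A B C : PadicAlgCl p} (ha : a ≠ 0) (hb : b ≠ 0) (hc : c ≠ 0)
    (hA : ‖A‖ = 1) (hB : ‖B‖ = 1) (hC : ‖C‖ = 1)
    (hinf : {m : ℕ | (1 + a * A ^ m) * (1 + b * B ^ m) + c * C ^ m = 0}.Infinite) :
    ∃ n : ℕ, 0 < n ∧ A ^ n = 1 ∧ B ^ n = 1 ∧ C ^ n = 1 := by
  have hp : (0 : ℝ) < p := by exact_mod_cast (Fact.out : p.Prime).pos
  have hδ : (0 : ℝ) < ((p : ℝ) * 2)⁻¹ := by positivity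
  obtain ⟨dA, hdA, hA'⟩ := exists_norm_pow_sub_one_le A hA hδ
  obtain ⟨dB, hdB, hB'⟩ := exists_norm_pow_sub_one_le B hB hδ
  obtain ⟨dC, hdC, hC'⟩ := exists_norm_pow_sub_one_le C hC hδ
  have hmul : ∀ {x : PadicAlgCl p} {e : ℕ} (q : ℕ), ‖x‖ = 1 → ‖x ^ e - 1‖ ≤ ((p : ℝ) * 2)⁻¹ →
      ‖x ^ (e * q) - 1‖ ≤ ((p : ℝ) * 2)⁻¹ := fun {x e} q hx h => by
    rw [pow_mul]
    exact norm_pow_sub_one_le_of_norm_sub_one_le (by simp [hx]) h q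
  obtain ⟨d, hd, hyA, hyB, hyC⟩ : ∃ d : ℕ, 0 < d ∧ ‖A ^ d - 1‖ ≤ ((p : ℝ) * 2)⁻¹ ∧
      ‖B ^ d - 1‖ ≤ ((p : ℝ) * 2)⁻¹ ∧ ‖C ^ d - 1‖ ≤ ((p : ℝ) * 2)⁻¹ := by
    refine ⟨dA * dB * dC, by positivity, ?_, ?_, ?_⟩
    · rw [mul_assoc]
      exact hmul _ hA hA'
    · rw [mul_comm dA, mul_assoc]
      exact hmul _ hB hB'
    · rw [mul_comm]
      exact hmul _ hC hC'
  have hyAB : ‖A ^ d * B ^ d - 1‖ ≤ ((p : ℝ) * 2)⁻¹ := by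
    have h1 : A ^ d * B ^ d - 1 = A ^ d * (B ^ d - 1) + (A ^ d - 1) := by ring
    rw [h1]
    refine (IsUltrametricDist.norm_add_le_max _ _).trans (max_le ?_ hyA)
    rwa [norm_mul, norm_pow, hA, one_pow, one_mul]
  obtain ⟨r, hr⟩ := hinf.exists_infinite_setOf_add_mul_mem hd
  have hf : HasBoundedInterpolation 2 fun k : ℕ => (1 + a * A ^ (r + d * k)) *
      (1 + b * B ^ (r + d * k)) + c * C ^ (r + d * k) := by
    have h1 := hasBoundedInterpolation_pow (y := (1 : PadicAlgCl p)) (by simp)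
    have hA := (hasBoundedInterpolation_pow hyA).const_mul two_pos (a * A ^ r)
    have hB := (hasBoundedInterpolation_pow hyB).const_mul two_pos (b * B ^ r)
    have hAB := (hasBoundedInterpolation_pow hyAB).const_mul two_pos (a * A ^ r * (b * B ^ r))
    have hC := (hasBoundedInterpolation_pow hyC).const_mul two_pos (c * C ^ r)
    convert (((h1.add zero_le_two hA).add zero_le_two hB).add zero_le_two hAB).add
      zero_le_two hC using 2 with k
    rw [one_pow, mul_pow]
    ring
  have hzero := hf.eq_zero one_lt_two hr
  have hA0 : A ≠ 0 := norm_ne_zero_iff.mp (by simp [hA])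
  have hB0 : B ≠ 0 := norm_ne_zero_iff.mp (by simp [hB])
  have hC0 : C ≠ 0 := norm_ne_zero_iff.mp (by simp [hC])
  obtain ⟨h1, h2, h3⟩ := sq_eq_one_of_forall_eq_zero (A := A ^ d) (B := B ^ d) (C := C ^ d)
    (mul_ne_zero ha (pow_ne_zero r hA0)) (mul_ne_zero hb (pow_ne_zero r hB0))
    (mul_ne_zero hc (pow_ne_zero r hC0)) (pow_ne_zero d hA0) (pow_ne_zero d hB0) fun k => by
      rw [← hzero k]
      ring
  exact ⟨d * 2, by positivity, by rw [pow_mul, h1], by rw [pow_mul, h2], by rw [pow_mul, h3]⟩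

theorem lemma11 (a b c A B C : ℂ) (ha : a ≠ 0) (hb : b ≠ 0) (hc : c ≠ 0)
    (hABC : A * B * C ≠ 0)
    (hinf : {m : ℕ | (1 + a * A ^ m) * (1 + b * B ^ m) + c * C ^ m = 0}.Infinite) :
    (∃ n : ℕ, 0 < n ∧ A ^ n = 1) ∧ (∃ n : ℕ, 0 < n ∧ B ^ n = 1) ∧
      (∃ n : ℕ, 0 < n ∧ C ^ n = 1) := by
  obtain ⟨⟨hA, hB⟩, hC⟩ : (A ≠ 0 ∧ B ≠ 0) ∧ C ≠ 0 := by simpa using hABC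
  -- Including the inverses makes the images of `A`, `B`, `C` have norm exactly one.
  obtain ⟨R, hfg, hmem⟩ : ∃ R : Subalgebra ℚ ℂ, Algebra.FiniteType ℚ R ∧
      ∀ x ∈ ({a, b, c, A, B, C, A⁻¹, B⁻¹, C⁻¹} : Set ℂ), x ∈ R :=
    ⟨Algebra.adjoin ℚ _, Subalgebra.fg_iff_finiteType _ |>.mp
      (Subalgebra.fg_def.mpr ⟨_, by simp, rfl⟩), fun x hx => Algebra.subset_adjoin hx⟩
  simp only [Set.mem_insert_iff, Set.mem_singleton_iff, forall_eq_or_imp, forall_eq] at hmem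
  obtain ⟨haR, hbR, hcR, hAR, hBR, hCR, hAR', hBR', hCR'⟩ := hmem
  lift a to R using haR
  lift b to R using hbR
  lift c to R using hcR
  obtain ⟨A', hA'⟩ : ∃ x : R, (x : ℂ) = A⁻¹ := ⟨⟨_, hAR'⟩, rfl⟩
  obtain ⟨B', hB'⟩ : ∃ x : R, (x : ℂ) = B⁻¹ := ⟨⟨_, hBR'⟩, rfl⟩
  obtain ⟨C', hC'⟩ : ∃ x : R, (x : ℂ) = C⁻¹ := ⟨⟨_, hCR'⟩, rfl⟩
  lift A to R using hAR
  lift B to R using hBR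
  lift C to R using hCR
  have hAA : A * A' = 1 := Subtype.ext (by simp [hA', hA])
  have hBB : B * B' = 1 := Subtype.ext (by simp [hB', hB])
  have hCC : C * C' = 1 := Subtype.ext (by simp [hC', hC])
  classical
  obtain ⟨p, _, φ, hφ, hle⟩ :=
    exists_injective_padicAlgCl_norm_le_one (R := R) {A, B, C, A', B', C'}
  have hunit : ∀ {x y : R}, ‖φ x‖ ≤ 1 → ‖φ y‖ ≤ 1 → x * y = 1 → ‖φ x‖ = 1 :=
    fun {x y} hx hy hxy => by
      have h1 : ‖φ x‖ * ‖φ y‖ = 1 := by rw [← norm_mul, ← map_mul, hxy, map_one, norm_one]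
      nlinarith [norm_nonneg (φ x), norm_nonneg (φ y)]
  have hne : ∀ {x : R}, (x : ℂ) ≠ 0 → φ x ≠ 0 := fun {x} hx h0 =>
    hx (by rw [(map_eq_zero_iff φ hφ).mp h0]; rfl)
  obtain ⟨n, hn, h1, h2, h3⟩ := PadicAlgCl.exists_pow_eq_one_of_infinite (hne ha) (hne hb) (hne hc)
    (hunit (hle A (by simp)) (hle A' (by simp)) hAA)
    (hunit (hle B (by simp)) (hle B' (by simp)) hBB)
    (hunit (hle C (by simp)) (hle C' (by simp)) hCC)
    (hinf.mono fun m hm => by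
      have h1 : (1 + a * A ^ m) * (1 + b * B ^ m) + c * C ^ m = 0 := Subtype.ext (by simpa using hm)
      simpa using congrArg φ h1)
  have hpow : ∀ {x : R}, φ x ^ n = 1 → (x : ℂ) ^ n = 1 := fun {x} hx => by
    have h1 : x ^ n = 1 := hφ (by rw [map_pow, hx, map_one])
    exact_mod_cast congrArg (fun y : R => (y : ℂ)) h1
  exact ⟨⟨n, hn, hpow h1⟩, ⟨n, hn, hpow h2⟩, ⟨n, hn, hpow h3⟩⟩
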